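/- Let $k$ be an algebraically closed field of characteristic zero. For a commutative $k$-algebra $R$, a $k$-algebra automorphism $\sigma$ of $R$ and $a\in R$, let $R(\sigma,a)$ denote the generalized Weyl algebra (GWA) of degree one, that is, the $k$-algebra generated over $R$ by two generators $x,y$ subject to the relations $xr=\sigma(r)x$ and $yr=\sigma^{-1}(r)y$ for all $r\in R$, $xy=\sigma(a)$, and $yx=a$. For $0\neq a\in k[h]$ the classical GWA is $A(a)=k[h](\sigma_{cl},a)$ with $\sigma_{cl}(h)=h-1$. For $q\in k^*$ and $0\neq a\in k[h]$ the quantum GWA is $A_q(a)=k[h](\sigma_q,a)$ with $\sigma_q(h)=qh$, and for $0\neq a\in k[h^{\pm1}]$ the localized quantum GWA is $A'_q(a)=k[h^{\pm1}](\sigma_q,a)$, again with $\sigma_q(h)=qh$. Two $k$-algebras are called Morita equivalent if their categories of left modules are equivalent by a $k$-linear equivalence. Then: 1. A classical GWA $A(a_1)$, with $0\neq a_1\in k[h]$, is never Morita equivalent to a quantum GWA: for every $q\in k^*$, it is Morita equivalent neither to $A_q(a_2)$ for any nonzero $a_2\in k[h]$, nor to $A'_q(a_2)$ for any nonzero $a_2\in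 k[h^{\pm1}]$. 2. Let $q_1,q_2\in k^*$ and let $a_1,a_2\in k[h]$ be nonzero. If $A_{q_1}(a_1)$ and $A_{q_2}(a_2)$ are Morita equivalent, then $\langle q_1\rangle=\langle q_2\rangle$, where $\langle q\rangle$ is the subgroup of $k^*$ generated by $q$. 3. Let $q_1,q_2\in k^*$ and let $a_1,a_2\in k[h^{\pm1}]$ be nonzero, such that the algebras $A'_{q_1}(a_1)$ and $A'_{q_2}(a_2)$ are simple. If they are Morita equivalent, then $q_2=q_1$ or $q_2=q_1^{-1}$. -/

import Mathlib

open scoped Polynomial LaurentPolynomial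

/-- Free generators for a generalized Weyl algebra over `R`: one for every `r : R`, and `x`, `y`. -/
inductive GWAGen (R : Type*) where
  | coeff (r : R) : GWAGen R
  | x : GWAGen R
  | y : GWAGen R

section GWA

variable {k : Type*} [CommRing k] {R : Type*} [CommRing R] [Algebra k R]

/-- The defining relations of `R(σ, a)`. The first four make `R → R(σ, a)` a homomorphism of
unital `k`-algebras, the others are `x r = σ(r) x`, `y r = σ⁻¹(r) y`, `x y = σ(a)`, `y x = a`. -/
inductive GWARel (σ : R ≃ₐ[k] R) (a : R) :
    FreeAlgebra k (GWAGen R) → FreeAlgebra k (GWAGen R) → Prop where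
  | coeff_add (r s : R) : GWARel σ a (FreeAlgebra.ι k (GWAGen.coeff (r + s)))
      (FreeAlgebra.ι k (GWAGen.coeff r) + FreeAlgebra.ι k (GWAGen.coeff s))
  | coeff_mul (r s : R) : GWARel σ a (FreeAlgebra.ι k (GWAGen.coeff (r * s)))
      (FreeAlgebra.ι k (GWAGen.coeff r) * FreeAlgebra.ι k (GWAGen.coeff s))
  | coeff_one : GWARel σ a (FreeAlgebra.ι k (GWAGen.coeff 1)) 1
  | coeff_algebraMap (c : k) : GWARel σ a (FreeAlgebra.ι k (GWAGen.coeff (algebraMap k R c)))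
      (algebraMap k (FreeAlgebra k (GWAGen R)) c)
  | x_coeff (r : R) : GWARel σ a
      (FreeAlgebra.ι k GWAGen.x * FreeAlgebra.ι k (GWAGen.coeff r))
      (FreeAlgebra.ι k (GWAGen.coeff (σ r)) * FreeAlgebra.ι k GWAGen.x)
  | y_coeff (r : R) : GWARel σ a
      (FreeAlgebra.ι k GWAGen.y * FreeAlgebra.ι k (GWAGen.coeff r))
      (FreeAlgebra.ι k (GWAGen.coeff (σ.symm r)) * FreeAlgebra.ι k GWAGen.y)
  | x_y : GWARel σ a (FreeAlgebra.ι k GWAGen.x * FreeAlgebra.ι k GWAGen.y)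
      (FreeAlgebra.ι k (GWAGen.coeff (σ a)))
  | y_x : GWARel σ a (FreeAlgebra.ι k GWAGen.y * FreeAlgebra.ι k GWAGen.x)
      (FreeAlgebra.ι k (GWAGen.coeff a))

/-- The generalized Weyl algebra `R(σ, a)` of degree one: the `k`-algebra generated over `R` by
`x` and `y` subject to `x r = σ(r) x`, `y r = σ⁻¹(r) y`, `x y = σ(a)`, `y x = a`. -/
abbrev GWA (σ : R ≃ₐ[k] R) (a : R) : Type _ := RingQuot (GWARel σ a)

end GWA

section Automorphisms

variable (k : Type*) [Field k]

/-- The automorphism `h ↦ h - 1` of `k[h]`. -/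
noncomputable def sigmaCl : k[X] ≃ₐ[k] k[X] :=
  Polynomial.algEquivOfCompEqX (Polynomial.X - 1) (Polynomial.X + 1) (by simp) (by simp)

variable {k}

/-- The automorphism `h ↦ q h` of `k[h]`. -/
noncomputable def sigmaQ (q : kˣ) : k[X] ≃ₐ[k] k[X] :=
  Polynomial.algEquivOfCompEqX (Polynomial.C (q : k) * Polynomial.X)
    (Polynomial.C ((q⁻¹ : kˣ) : k) * Polynomial.X)
    (by simp [← mul_assoc, ← Polynomial.C_mul]) (by simp [← mul_assoc, ← Polynomial.C_mul])

/-- The endomorphism `h ↦ q h` of `k[h, h⁻¹]`, that is, `h ^ n ↦ q ^ n h ^ n`. -/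
noncomputable def laurentScale (q : kˣ) : k[T;T⁻¹] →ₐ[k] k[T;T⁻¹] :=
  AddMonoidAlgebra.lift k k[T;T⁻¹] ℤ
    { toFun := fun n => ((q ^ n.toAdd : kˣ) : k) • LaurentPolynomial.T n.toAdd
      map_one' := by simp
      map_mul' := fun m n => by
        simp only [toAdd_mul, zpow_add, LaurentPolynomial.T_add, Units.val_mul,
          smul_mul_smul_comm] }

theorem laurentScale_T (q : kˣ) (n : ℤ) :
    laurentScale q (LaurentPolynomial.T n) = ((q ^ n : kˣ) : k) • LaurentPolynomial.T n := by
  exact (AddMonoidAlgebra.lift_single _ _ _).trans (one_smul _ _)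

theorem laurentScale_comp (p q : kˣ) (h : p * q = 1) :
    (laurentScale p).comp (laurentScale q) = AlgHom.id k k[T;T⁻¹] := by
  apply (AddMonoidAlgebra.lift k k[T;T⁻¹] ℤ).symm.injective
  refine MonoidHom.ext fun n => ?_
  change laurentScale p (laurentScale q (LaurentPolynomial.T n.toAdd)) =
    LaurentPolynomial.T n.toAdd
  rw [laurentScale_T, map_smul, laurentScale_T, smul_smul, ← Units.val_mul, ← mul_zpow,
    mul_comm q p, h]
  simp

/-- The automorphism `h ↦ q h` of `k[h, h⁻¹]`. -/
noncomputable def sigmaQLaurent (q : kˣ) : k[T;T⁻¹] ≃ₐ[k] k[T;T⁻¹] :=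
  AlgEquiv.ofAlgHom (laurentScale q) (laurentScale q⁻¹)
    (laurentScale_comp q q⁻¹ (by simp)) (laurentScale_comp q⁻¹ q (by simp))

end Automorphisms

section Families

variable {k : Type*} [Field k]

/-- The classical generalized Weyl algebra `A(a) = k[h](σ_cl, a)`, with `σ_cl(h) = h - 1`. -/
abbrev ClassicalGWA (a : k[X]) : Type _ := GWA (sigmaCl k) a

/-- The quantum generalized Weyl algebra `A_q(a) = k[h](σ_q, a)`, with `σ_q(h) = q h`. -/
abbrev QuantumGWA (q : kˣ) (a : k[X]) : Type _ := GWA (sigmaQ q) a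

/-- The localized quantum generalized Weyl algebra `A'_q(a) = k[h, h⁻¹](σ_q, a)`. -/
abbrev LaurentQuantumGWA (q : kˣ) (a : k[T;T⁻¹]) : Type _ := GWA (sigmaQLaurent q) a

end Families

/-!
The GWA `R(σ, a)` over a domain embeds into the skew Laurent ring `R[x, x⁻¹; σ]` by `y = a x⁻¹`.
Hence it is a domain, it is left Ore by counting degrees, and a multiplicative function `l` on `R`
with `l ∘ σ = l` extends to it through leading coefficients.

If a domain `A` is Morita equivalent to a left Ore domain `B`, then `Aᵒᵖ` is the endomorphism ring
of a projective `B`-module, which embeds into `B` as a left ideal `I`. A multiplicative function `L`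
on `B` with values in a commutative group with zero induces one on `Aᵒᵖ`, namely
`f ↦ L (f p) / L p` for any `0 ≠ p ∈ I`, which agrees with `L` on scalars. So a relation
`u v = q v u` between nonzero elements of `A` forces `L q = 1`.

Apply this to `x h = q h x` in a quantum GWA, with `L` the leading coefficient in `R(σ, a)`, then in
`R`, then modulo a subgroup `H` of `kˣ` that makes it `σ`-invariant: `H` is trivial for a classical
`B` and `⟨q₂⟩` for a quantum one, so that `q ∈ H`. What remains of the first part is `q = 1`, where
one algebra is commutative and the other is not. In the third part, simplicity excludes roots of
unity because `hⁿ - 1` is central when `qⁿ = 1`.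
-/

section Morita

open CategoryTheory
open scoped ModuleCat.Algebra

universe u

variable {k : Type*} {A B : Type u} [CommRing k] [Ring A] [Algebra k A] [Ring B] [Algebra k B]

theorem moritaEquivalence_map_hom_apply (e : MoritaEquivalence k A B) {M : ModuleCat.{u} A}
    {f : M ⟶ M} {c : k} (hf : ∀ m : M, f.hom m = algebraMap k A c • m)
    (p : e.eqv.functor.obj M) : (e.eqv.functor.map f).hom p = algebraMap k B c • p := by
  have hfc : f = c • 𝟙 M := ModuleCat.hom_ext (LinearMap.ext hf)
  rw [hfc, Functor.map_smul, CategoryTheory.Functor.map_id]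
  rfl

theorem exists_projective_ringEquiv_end_of_isMoritaEquivalent (h : IsMoritaEquivalent k A B) :
    ∃ (P : Type u) (_ : AddCommGroup P) (_ : Module B P) (F : Aᵐᵒᵖ ≃+* Module.End B P),
      Module.Projective B P ∧
        ∀ (c : k) (p : P), F (.op (algebraMap k A c)) p = algebraMap k B c • p := by
  obtain ⟨e⟩ := h.cond
  let Q : ModuleCat.{u} A := ModuleCat.of A A
  let P : ModuleCat.{u} B := e.eqv.functor.obj Q
  let E : End Q ≃+* End P :=
    { e.eqv.fullyFaithfulFunctor.mulEquivEnd Q with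
      map_add' := fun _ _ => e.eqv.functor.map_add }
  let F : Aᵐᵒᵖ ≃+* Module.End B P := (RingEquiv.moduleEndSelf A).trans
    ((ModuleCat.endRingEquiv Q).symm.trans (E.trans (ModuleCat.endRingEquiv P)))
  have : Projective Q := (IsProjective.iff_projective A).mp inferInstance
  have : Projective P := (e.eqv.map_projective_iff Q).mpr this
  exact ⟨P, inferInstance, inferInstance, F, (IsProjective.iff_projective P).mpr this,
    fun c => moritaEquivalence_map_hom_apply e fun m => (Algebra.commutes c m).symm⟩

end Morita

section EmbeddedModule

variable {B P : Type*} [Ring B] [AddCommGroup P] [Module B P]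

theorem exists_injective_of_noZeroDivisors_end [NoZeroDivisors B] [Nontrivial P]
    [Module.Projective B P] [NoZeroDivisors (Module.End B P)] :
    ∃ φ : P →ₗ[B] B, Function.Injective φ := by
  obtain ⟨s, hs⟩ := Module.Projective.out (R := B) (P := P)
  have hs_inj : Function.Injective s := hs.injective
  obtain ⟨p₀, hp₀⟩ := exists_ne (0 : P)
  obtain ⟨i, hi⟩ := Finsupp.ne_iff.mp ((map_ne_zero_iff s hs_inj).mpr hp₀)
  let φ : P →ₗ[B] B := Finsupp.lapply i ∘ₗ s
  refine ⟨φ, (injective_iff_map_eq_zero φ).mpr fun p hp => ?_⟩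
  have hnil : φ.smulRight p * φ.smulRight p = 0 := by
    ext q
    simp [hp]
  have hp' : φ p₀ • p = 0 := by simpa using LinearMap.congr_fun (mul_self_eq_zero.mp hnil) p₀
  have hsp : φ p₀ • s p = 0 := by rw [← map_smul, hp', map_zero]
  refine (map_eq_zero_iff s hs_inj).mp (Finsupp.ext fun j => ?_)
  exact (mul_eq_zero.mp (DFunLike.congr_fun hsp j)).resolve_left hi

theorem end_mul_comm_of_injective [NoZeroDivisors B] (hB : ∀ b c : B, b * c = c * b)
    {φ : P →ₗ[B] B} (hφ : Function.Injective φ) (f g : Module.End B P) : f * g = g * f := by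
  have smul_symm (p q : P) : φ p • q = φ q • p := hφ (by simp [hB])
  ext p
  obtain rfl | hp := eq_or_ne p 0
  · simp
  have key : φ p • f (g p) = φ p • g (f p) :=
    calc φ p • f (g p) = φ (g p) • f p := by rw [← map_smul, smul_symm p, map_smul]
      _ = φ (f p) • g p := smul_symm _ _
      _ = φ p • g (f p) := by rw [← map_smul, smul_symm _ p, map_smul]
  refine hφ (mul_left_cancel₀ ((map_ne_zero_iff φ hφ).mpr hp) ?_)
  simpa using congrArg φ key

variable {Γ : Type*} [CommGroupWithZero Γ] {L : B →*₀ Γ} (hL : ∀ b, L b = 0 → b = 0)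
  {φ : P →ₗ[B] B} (hφ : Function.Injective φ)

include hL

theorem mem_nonZeroDivisors_iff_map_ne_zero {b : B} : b ∈ nonZeroDivisors B ↔ L b ≠ 0 := by
  refine ⟨fun hb h => ?_, fun hb => mem_nonZeroDivisors_iff.mpr ⟨fun c hc => hL c ?_,
    fun c hc => hL c ?_⟩⟩
  · have h10 : (1 : B) = 0 := (mem_nonZeroDivisors_iff.mp hb).1 1 (by rw [hL b h, zero_mul])
    exact one_ne_zero ((map_one L).symm.trans (by rw [h10, map_zero]))
  · exact (mul_eq_zero.mp (by rw [← map_mul, hc, map_zero])).resolve_left hb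
  · exact (mul_eq_zero.mp (by rw [← map_mul, hc, map_zero])).resolve_right hb

include hφ

theorem map_apply_eq_zero_iff {p : P} : L (φ p) = 0 ↔ p = 0 :=
  ⟨fun h => (map_eq_zero_iff φ hφ).mp (hL _ h), fun h => by rw [h, map_zero, map_zero]⟩

variable [OreLocalization.OreSet (nonZeroDivisors B)]

theorem map_end_apply_mul_comm (f : Module.End B P) (p q : P) :
    L (φ (f p)) * L (φ q) = L (φ (f q)) * L (φ p) := by
  obtain rfl | hq := eq_or_ne q 0
  · simp
  have hq' : φ q ∈ nonZeroDivisors B :=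
    (mem_nonZeroDivisors_iff_map_ne_zero hL).mpr ((map_apply_eq_zero_iff hL hφ).not.mpr hq)
  obtain ⟨n, d, hnd⟩ : ∃ (n : B) (d : nonZeroDivisors B), d * φ p = n * φ q :=
    ⟨_, _, OreLocalization.ore_eq (φ p) ⟨φ q, hq'⟩⟩
  have hmul : (d : B) • p = n • q := hφ (by simpa using hnd)
  have hmap : L d * L (φ p) = L n * L (φ q) := by rw [← map_mul, hnd, map_mul]
  have hmap' : L d * L (φ (f p)) = L n * L (φ (f q)) := by
    simpa using congrArg (fun r => L (φ (f r))) hmul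
  have hd : L d ≠ 0 := (mem_nonZeroDivisors_iff_map_ne_zero hL).mp d.2
  refine mul_left_cancel₀ hd ?_
  calc L d * (L (φ (f p)) * L (φ q)) = L (φ (f q)) * (L n * L (φ q)) := by
        rw [← mul_assoc, hmap', mul_comm (L n), mul_assoc]
    _ = L d * (L (φ (f q)) * L (φ p)) := by rw [← hmap, mul_left_comm]

variable [Nontrivial P]

/-- The extension of a multiplicative function `L` on a left Ore domain to the endomorphisms of a
left ideal `φ : P ↪ B`: the common value of `L (φ (f p)) / L (φ p)` for all `p ≠ 0`, computed at
an arbitrary one. -/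
noncomputable def endRatio : Module.End B P →*₀ Γ where
  toFun f := L (φ (f (exists_ne (0 : P)).choose)) / L (φ (exists_ne (0 : P)).choose)
  map_zero' := by simp
  map_one' := div_self ((map_apply_eq_zero_iff hL hφ).not.mpr (exists_ne (0 : P)).choose_spec)
  map_mul' f g := by
    have hp := (map_apply_eq_zero_iff hL hφ).not.mpr (exists_ne (0 : P)).choose_spec
    rw [← mul_div_assoc, div_left_inj' hp, div_mul_eq_mul_div, eq_div_iff hp]
    exact map_end_apply_mul_comm hL hφ f _ _

theorem endRatio_mul_map_apply (f : Module.End B P) (p : P) :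
    endRatio hL hφ f * L (φ p) = L (φ (f p)) :=
  (div_mul_eq_mul_div _ _ _).trans ((div_eq_iff ((map_apply_eq_zero_iff hL hφ).not.mpr
    (exists_ne (0 : P)).choose_spec)).mpr (map_end_apply_mul_comm hL hφ f _ p))

theorem eq_zero_of_endRatio_eq_zero {f : Module.End B P} (hf : endRatio hL hφ f = 0) : f = 0 :=
  LinearMap.ext fun p => (map_apply_eq_zero_iff hL hφ).mp <| by
    rw [← endRatio_mul_map_apply hL hφ, hf, zero_mul]

theorem endRatio_eq_of_forall_apply_eq_smul {f : Module.End B P} {b : B}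
    (hf : ∀ p, f p = b • p) : endRatio hL hφ f = L b := by
  obtain ⟨p, hp⟩ := exists_ne (0 : P)
  refine mul_right_cancel₀ ((map_apply_eq_zero_iff hL hφ).not.mpr hp) ?_
  rw [endRatio_mul_map_apply, hf, map_smul, smul_eq_mul, map_mul]

end EmbeddedModule

section MoritaDomain

universe u

variable {k : Type*} {A B : Type u} [CommRing k] [Ring A] [IsDomain A] [Algebra k A] [Ring B]
  [NoZeroDivisors B] [Algebra k B]

theorem exists_embedded_ringEquiv_end_of_isMoritaEquivalent (h : IsMoritaEquivalent k A B) :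
    ∃ (P : Type u) (_ : AddCommGroup P) (_ : Module B P) (F : Aᵐᵒᵖ ≃+* Module.End B P)
      (φ : P →ₗ[B] B), Nontrivial P ∧ Function.Injective φ ∧
        ∀ (c : k) (p : P), F (.op (algebraMap k A c)) p = algebraMap k B c • p := by
  obtain ⟨P, _, _, F, _, hF⟩ := exists_projective_ringEquiv_end_of_isMoritaEquivalent h
  have : Nontrivial (Module.End B P) := F.symm.toEquiv.nontrivial
  have : Nontrivial P := by
    by_contra hP
    have := not_nontrivial_iff_subsingleton.mp hP
    exact not_subsingleton (Module.End B P) inferInstance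
  have : NoZeroDivisors (Module.End B P) :=
    F.symm.injective.noZeroDivisors _ (map_zero _) (map_mul _)
  obtain ⟨φ, hφ⟩ := exists_injective_of_noZeroDivisors_end (B := B) (P := P)
  exact ⟨P, _, _, F, φ, ‹_›, hφ, hF⟩

theorem exists_monoidWithZeroHom_of_isMoritaEquivalent (h : IsMoritaEquivalent k A B)
    [OreLocalization.OreSet (nonZeroDivisors B)] {Γ : Type*} [CommGroupWithZero Γ] {L : B →*₀ Γ}
    (hL : ∀ b, L b = 0 → b = 0) :
    ∃ L' : A →*₀ Γ, (∀ a, L' a = 0 → a = 0) ∧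
      ∀ c : k, L' (algebraMap k A c) = L (algebraMap k B c) := by
  obtain ⟨P, _, _, F, φ, _, hφ, hF⟩ := exists_embedded_ringEquiv_end_of_isMoritaEquivalent h
  refine ⟨⟨⟨fun a => endRatio hL hφ (F (.op a)), by simp⟩, by simp, fun a b => ?_⟩,
    fun a ha => ?_, fun c => endRatio_eq_of_forall_apply_eq_smul hL hφ (hF c)⟩
  · exact (by simp [mul_comm] : endRatio hL hφ (F (.op (a * b))) =
      endRatio hL hφ (F (.op a)) * endRatio hL hφ (F (.op b)))
  · have hFa : F (.op a) = 0 := eq_zero_of_endRatio_eq_zero hL hφ ha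
    exact (MulOpposite.op_eq_zero_iff a).mp ((map_eq_zero_iff F F.injective).mp hFa)

theorem map_algebraMap_eq_one_of_isMoritaEquivalent (h : IsMoritaEquivalent k A B)
    [OreLocalization.OreSet (nonZeroDivisors B)] {Γ : Type*} [CommGroupWithZero Γ] {L : B →*₀ Γ}
    (hL : ∀ b, L b = 0 → b = 0) {a b : A} (ha : a ≠ 0) (hb : b ≠ 0) {c : k}
    (hab : a * b = algebraMap k A c * (b * a)) : L (algebraMap k B c) = 1 := by
  obtain ⟨L', hL', hc⟩ := exists_monoidWithZeroHom_of_isMoritaEquivalent h hL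
  have hba : L' b * L' a ≠ 0 := mul_ne_zero (mt (hL' b) hb) (mt (hL' a) ha)
  refine mul_right_cancel₀ hba ?_
  rw [← hc, one_mul, ← map_mul, ← map_mul, ← hab, map_mul, map_mul, mul_comm]

theorem mul_comm_of_isMoritaEquivalent (h : IsMoritaEquivalent k A B)
    (hB : ∀ b c : B, b * c = c * b) (a b : A) : a * b = b * a := by
  obtain ⟨P, _, _, F, φ, _, hφ, -⟩ := exists_embedded_ringEquiv_end_of_isMoritaEquivalent h
  refine MulOpposite.op_injective (F.injective ?_)
  rw [MulOpposite.op_mul, MulOpposite.op_mul, map_mul, map_mul]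
  exact end_mul_comm_of_injective hB hφ _ _

end MoritaDomain

section TopCoefficient

variable {R : Type*} [Semiring R]

/-- The largest degree in the support of `f`. As `sSup ∅ = 0` in `ℤ`, it is `0` for `f = 0`. -/
noncomputable def topDegree (f : ℤ →₀ R) : ℤ := sSup (f.support : Set ℤ)

/-- The leading coefficient of `f`, read as a (skew) Laurent polynomial. -/
noncomputable def topCoeff (f : ℤ →₀ R) : R := f (topDegree f)

theorem isGreatest_topDegree {f : ℤ →₀ R} (hf : f ≠ 0) :
    IsGreatest (f.support : Set ℤ) (topDegree f) := by
  have h := f.support.isGreatest_max' (Finsupp.support_nonempty_iff.mpr hf)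
  rwa [topDegree, h.csSup_eq]

theorem apply_eq_zero_of_topDegree_lt {f : ℤ →₀ R} {n : ℤ} (hn : topDegree f < n) : f n = 0 := by
  obtain rfl | hf := eq_or_ne f 0
  · rfl
  · exact Finsupp.notMem_support_iff.mp fun h => hn.not_ge ((isGreatest_topDegree hf).2 h)

theorem topCoeff_eq_zero_iff {f : ℤ →₀ R} : topCoeff f = 0 ↔ f = 0 := by
  refine ⟨fun h => ?_, fun h => by rw [h, topCoeff, Finsupp.zero_apply]⟩
  by_contra hf
  exact Finsupp.mem_support_iff.mp (isGreatest_topDegree hf).1 h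

theorem topCoeff_eq_apply {f : ℤ →₀ R} {n : ℤ} (hn : f n ≠ 0) (h : ∀ j, n < j → f j = 0) :
    topCoeff f = f n := by
  have hgreatest : IsGreatest (f.support : Set ℤ) n :=
    ⟨Finsupp.mem_support_iff.mpr hn, fun j hj => not_lt.mp fun hlt =>
      Finsupp.mem_support_iff.mp hj (h j hlt)⟩
  rw [topCoeff, topDegree, hgreatest.csSup_eq]

theorem topCoeff_single (n : ℤ) (r : R) : topCoeff (Finsupp.single n r) = r := by
  obtain rfl | hr := eq_or_ne r 0
  · rw [Finsupp.single_zero, topCoeff_eq_zero_iff]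
  · rw [topCoeff_eq_apply (n := n) (by simpa using hr), Finsupp.single_eq_same]
    exact fun j hj => Finsupp.single_eq_of_ne hj.ne'

theorem topCoeff_eq_mul_of_convolution [NoZeroDivisors R] {τ : ℤ → R → R}
    (hτ : ∀ i r, τ i r = 0 ↔ r = 0) {f g h : ℤ →₀ R}
    (hh : ∀ j, h j = f.sum fun i r => r * τ i (g (j - i))) :
    topCoeff h = topCoeff f * τ (topDegree f) (topCoeff g) := by
  have hterm {i j : ℤ} (hij : topDegree f < i ∨ topDegree g < j - i) :
      f i * τ i (g (j - i)) = 0 := by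
    obtain hi | hi := hij
    · rw [apply_eq_zero_of_topDegree_lt hi, zero_mul]
    · rw [(hτ i _).mpr (apply_eq_zero_of_topDegree_lt hi), mul_zero]
  have htop : h (topDegree f + topDegree g) = topCoeff f * τ (topDegree f) (topCoeff g) := by
    rw [hh, Finsupp.sum, Finset.sum_eq_single (topDegree f), add_sub_cancel_left,
      topCoeff, topCoeff]
    · exact fun i _ hi => hterm (by omega)
    · exact fun hf => by rw [Finsupp.notMem_support_iff.mp hf, zero_mul]
  have hhigh (j : ℤ) (hj : topDegree f + topDegree g < j) : h j = 0 :=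
    (hh j).trans (Finset.sum_eq_zero fun i _ => hterm (by omega))
  by_cases hzero : topCoeff f * τ (topDegree f) (topCoeff g) = 0
  · have hfg : f = 0 ∨ g = 0 := by simpa [hτ, topCoeff_eq_zero_iff] using hzero
    have hh0 : h = 0 := Finsupp.ext fun j => by
      obtain rfl | rfl := hfg <;> simp [hh, (hτ _ 0).mpr]
    rw [hzero, topCoeff_eq_zero_iff, hh0]
  · rw [← htop] at hzero ⊢
    exact topCoeff_eq_apply hzero hhigh

end TopCoefficient

theorem card_le_card_of_linearIndependent_of_support_subset {R α ι : Type*} [Semiring R]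
    [StrongRankCondition R] [Fintype ι] {f : ι → α →₀ R} (hf : LinearIndependent R f)
    {s : Finset α} (hs : ∀ i, (f i).support ⊆ s) : Fintype.card ι ≤ s.card := by
  have hf' : LinearIndependent R fun i =>
      (⟨f i, Finset.coe_subset.mpr (hs i)⟩ : Finsupp.supported R R (s : Set α)) :=
    .of_comp (Submodule.subtype _) hf
  let e : Finsupp.supported R R (s : Set α) ≃ₗ[R] (s : Set α) →₀ R :=
    Finsupp.supportedEquivFinsupp (s : Set α)
  have := Module.Finite.equiv e.symm
  simpa [e.finrank_eq] using hf'.fintype_card_le_finrank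

section UnitsHom

variable {k G : Type*} [Field k] [CommGroup G]

/-- A homomorphism `kˣ → G`, extended to `k → G ∪ {0}` by `0 ↦ 0`. -/
noncomputable def withZeroHomOfUnits (f : kˣ →* G) : k →*₀ WithZero G :=
  open Classical in (WithZero.map' f).comp
    (WithZero.withZeroUnitsEquiv (G := k)).symm.toMonoidWithZeroHom

theorem withZeroHomOfUnits_eq_one_iff {f : kˣ →* G} {u : kˣ} :
    withZeroHomOfUnits f (u : k) = 1 ↔ u ∈ f.ker := by
  have hu : withZeroHomOfUnits f (u : k) = (f u : WithZero G) := by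
    simp [withZeroHomOfUnits]
  rw [hu, MonoidHom.mem_ker]
  exact WithZero.coe_inj

end UnitsHom

namespace GWA

section Generators

variable {k : Type*} [CommRing k] {R : Type*} [CommRing R] [Algebra k R] (σ : R ≃ₐ[k] R) (a : R)

/-- The canonical homomorphism from the coefficient ring. -/
noncomputable def coeff : R →ₐ[k] GWA σ a :=
  AlgHom.ofLinearMap
    { toFun := fun r => RingQuot.mkAlgHom k (GWARel σ a) (FreeAlgebra.ι k (GWAGen.coeff r))
      map_add' := fun r s => by
        rw [← map_add]; exact RingQuot.mkAlgHom_rel k (GWARel.coeff_add r s)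
      map_smul' := fun c r => by
        rw [Algebra.smul_def, RingQuot.mkAlgHom_rel k (GWARel.coeff_mul _ _), map_mul,
          RingQuot.mkAlgHom_rel k (GWARel.coeff_algebraMap c), AlgHom.commutes, ← Algebra.smul_def]
        rfl }
    ((RingQuot.mkAlgHom_rel k GWARel.coeff_one).trans (map_one _))
    (fun r s => (RingQuot.mkAlgHom_rel k (GWARel.coeff_mul r s)).trans (map_mul _ _ _))

/-- The generator `x`. -/
noncomputable def x : GWA σ a := RingQuot.mkAlgHom k (GWARel σ a) (FreeAlgebra.ι k GWAGen.x)

/-- The generator `y`. -/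
noncomputable def y : GWA σ a := RingQuot.mkAlgHom k (GWARel σ a) (FreeAlgebra.ι k GWAGen.y)

theorem x_mul_coeff (r : R) : x σ a * coeff σ a r = coeff σ a (σ r) * x σ a :=
  ((map_mul _ _ _).symm.trans (RingQuot.mkAlgHom_rel k (GWARel.x_coeff r))).trans (map_mul _ _ _)

theorem y_mul_coeff (r : R) : y σ a * coeff σ a r = coeff σ a (σ.symm r) * y σ a :=
  ((map_mul _ _ _).symm.trans (RingQuot.mkAlgHom_rel k (GWARel.y_coeff r))).trans (map_mul _ _ _)

theorem x_mul_y : x σ a * y σ a = coeff σ a (σ a) :=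
  (map_mul _ _ _).symm.trans (RingQuot.mkAlgHom_rel k GWARel.x_y)

theorem y_mul_x : y σ a * x σ a = coeff σ a a :=
  (map_mul _ _ _).symm.trans (RingQuot.mkAlgHom_rel k GWARel.y_x)

variable {σ a}

@[elab_as_elim]
theorem induction {motive : GWA σ a → Prop} (coeff : ∀ r, motive (coeff σ a r))
    (x : motive (x σ a)) (y : motive (y σ a)) (mul : ∀ b c, motive b → motive c → motive (b * c))
    (add : ∀ b c, motive b → motive c → motive (b + c)) (b : GWA σ a) : motive b := by
  obtain ⟨b, rfl⟩ := RingQuot.mkAlgHom_surjective k (GWARel σ a) b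
  induction b using FreeAlgebra.induction with
  | grade0 c =>
    rw [AlgHom.commutes, ← AlgHom.commutes (GWA.coeff σ a)]
    exact coeff _
  | grade1 g =>
    cases g with
    | coeff r => exact coeff r
    | x => exact x
    | y => exact y
  | mul b c hb hc => rw [map_mul]; exact mul _ _ hb hc
  | add b c hb hc => rw [map_add]; exact add _ _ hb hc

theorem commute_of_commute_generators {b : GWA σ a} (hcoeff : ∀ r, Commute b (coeff σ a r))
    (hx : Commute b (x σ a)) (hy : Commute b (y σ a)) (c : GWA σ a) : Commute b c := by
  induction c using GWA.induction with
  | coeff r => exact hcoeff r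
  | x => exact hx
  | y => exact hy
  | mul c d hc hd => exact hc.mul_right hd
  | add c d hc hd => exact hc.add_right hd

theorem commute_coeff_of_fixed {r : R} (hr : σ r = r) (c : GWA σ a) : Commute (coeff σ a r) c := by
  refine commute_of_commute_generators (fun s => (Commute.all r s).map (coeff σ a)) ?_ ?_ c
  · exact (show x σ a * coeff σ a r = coeff σ a r * x σ a by rw [x_mul_coeff, hr]).symm
  · exact (show y σ a * coeff σ a r = coeff σ a r * y σ a by
      rw [y_mul_coeff, σ.symm_apply_eq.mpr hr.symm]).symm

theorem commute_of_eq_refl (b c : GWA (AlgEquiv.refl : R ≃ₐ[k] R) a) : Commute b c := by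
  have hcoeff (r : R) (d : GWA (AlgEquiv.refl : R ≃ₐ[k] R) a) : Commute d (coeff _ a r) :=
    (commute_coeff_of_fixed rfl d).symm
  have hxy : Commute (x (AlgEquiv.refl : R ≃ₐ[k] R) a) (y _ a) :=
    (x_mul_y _ a).trans (y_mul_x _ a).symm
  have hx : ∀ d, Commute (x (AlgEquiv.refl : R ≃ₐ[k] R) a) d :=
    commute_of_commute_generators (hcoeff · _) (Commute.refl _) hxy
  have hy : ∀ d, Commute (y (AlgEquiv.refl : R ≃ₐ[k] R) a) d :=
    commute_of_commute_generators (hcoeff · _) hxy.symm (Commute.refl _)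
  exact commute_of_commute_generators (hcoeff · b) (hx b).symm (hy b).symm c

variable (σ a)

/-- Multiplication by `xⁿ` on the skew Laurent polynomials `R[x, x⁻¹; σ]`, which are written as
`∑ fᵢ xⁱ` and encoded by their coefficients `f : ℤ →₀ R`. -/
noncomputable def skewShift (n : ℤ) : Module.End k (ℤ →₀ R) :=
  (Finsupp.domLCongr (Equiv.addRight n)).toLinearMap ∘ₗ
    Finsupp.mapRange.linearMap (σ ^ n).toLinearMap

@[simp]
theorem skewShift_apply (n : ℤ) (f : ℤ →₀ R) (j : ℤ) :
    skewShift σ n f j = (σ ^ n) (f (j - n)) := by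
  simp [skewShift, Finsupp.domLCongr_apply, sub_eq_add_neg]

theorem skewShift_single (n i : ℤ) (r : R) :
    skewShift σ n (.single i r) = .single (i + n) ((σ ^ n) r) := by
  simp [skewShift, Finsupp.domLCongr_apply]

theorem skewShift_zero : skewShift σ 0 = 1 := by
  ext : 2
  simp [skewShift_single]

theorem skewShift_add (m n : ℤ) : skewShift σ (m + n) = skewShift σ m * skewShift σ n := by
  refine LinearMap.ext fun f => Finsupp.ext fun j => ?_
  simp [zpow_add, sub_sub]

theorem skewShift_mul_lsmul (n : ℤ) (r : R) :
    skewShift σ n * Algebra.lsmul k k (ℤ →₀ R) r =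
      Algebra.lsmul k k (ℤ →₀ R) ((σ ^ n) r) * skewShift σ n := by
  refine LinearMap.ext fun f => Finsupp.ext fun j => ?_
  simp

/-- The representation of `R(σ, a)` on `R[x, x⁻¹; σ]` by left multiplication, with `y = a x⁻¹`. -/
noncomputable def toEnd : GWA σ a →ₐ[k] Module.End k (ℤ →₀ R) :=
  RingQuot.liftAlgHom k ⟨FreeAlgebra.lift k fun
    | .coeff r => Algebra.lsmul k k (ℤ →₀ R) r
    | .x => skewShift σ 1
    | .y => Algebra.lsmul k k (ℤ →₀ R) a * skewShift σ (-1), fun _ _ h => by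
    cases h <;> refine LinearMap.ext fun f => Finsupp.ext fun j => ?_ <;>
      simp [mul_assoc, Algebra.smul_def]
    ring⟩

theorem toEnd_coeff (r : R) : toEnd σ a (coeff σ a r) = Algebra.lsmul k k (ℤ →₀ R) r := by
  change toEnd σ a (RingQuot.mkAlgHom k (GWARel σ a) _) = _
  simp [toEnd]

theorem toEnd_x : toEnd σ a (x σ a) = skewShift σ 1 := by
  simp [toEnd, x]

theorem toEnd_y : toEnd σ a (y σ a) = Algebra.lsmul k k (ℤ →₀ R) a * skewShift σ (-1) := by
  simp [toEnd, y]

theorem toEnd_coeff_mul_apply (r : R) (b : GWA σ a) (f : ℤ →₀ R) :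
    toEnd σ a (coeff σ a r * b) f = r • toEnd σ a b f := by
  rw [map_mul, toEnd_coeff]
  rfl

/-- The left `R`-module structure of `R(σ, a)`. It is not an algebra structure, as `R` is not
central. -/
noncomputable abbrev leftModule : Module R (GWA σ a) :=
  Module.compHom _ (coeff σ a : R →+* GWA σ a)

attribute [local instance] leftModule

variable {σ a} in
theorem smul_def (r : R) (b : GWA σ a) : r • b = coeff σ a r * b := rfl

theorem isScalarTower_leftModule : IsScalarTower R (GWA σ a) (GWA σ a) :=
  ⟨fun _ _ _ => mul_assoc _ _ _⟩

attribute [local instance] isScalarTower_leftModule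

/-- The generators of `R(σ, a)` as a left `R`-module: the powers of `x` in nonnegative degrees and
those of `y` in negative ones. -/
noncomputable def monomial : ℤ → GWA σ a
  | .ofNat n => x σ a ^ n
  | .negSucc n => y σ a ^ (n + 1)

theorem monomial_natCast (n : ℕ) : monomial σ a n = x σ a ^ n := rfl

theorem monomial_neg_natCast (n : ℕ) : monomial σ a (-n) = y σ a ^ n := by
  cases n with
  | zero => simpa using monomial_natCast σ a 0
  | succ n => rfl

theorem monomial_zero : monomial σ a 0 = 1 := by
  simpa using monomial_natCast σ a 0

theorem exists_x_mul_monomial_eq_smul (i : ℤ) :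
    ∃ r : R, x σ a * monomial σ a i = r • monomial σ a (i + 1) := by
  obtain ⟨n, rfl | rfl⟩ := i.eq_nat_or_neg
  · exact ⟨1, by rw [one_smul, monomial_natCast, ← pow_succ', ← monomial_natCast, Nat.cast_succ]⟩
  obtain _ | n := n
  · exact ⟨1, by simpa [monomial_zero] using (monomial_natCast σ a 1).symm⟩
  · refine ⟨σ a, ?_⟩
    rw [show -((n + 1 : ℕ) : ℤ) + 1 = -(n : ℤ) by push_cast; ring, monomial_neg_natCast,
      monomial_neg_natCast, pow_succ', ← mul_assoc, x_mul_y, smul_def]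

theorem exists_y_mul_monomial_eq_smul (i : ℤ) :
    ∃ r : R, y σ a * monomial σ a i = r • monomial σ a (i - 1) := by
  obtain ⟨n, rfl | rfl⟩ := i.eq_nat_or_neg
  · obtain _ | n := n
    · exact ⟨1, by simpa [monomial_zero] using (monomial_neg_natCast σ a 1).symm⟩
    · refine ⟨a, ?_⟩
      rw [show ((n + 1 : ℕ) : ℤ) - 1 = (n : ℤ) by push_cast; ring, monomial_natCast,
        monomial_natCast, pow_succ', ← mul_assoc, y_mul_x, smul_def]
  · refine ⟨1, ?_⟩
    rw [show -(n : ℤ) - 1 = -((n + 1 : ℕ) : ℤ) by push_cast; ring, monomial_neg_natCast,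
      monomial_neg_natCast, one_smul, pow_succ']

variable {σ a} in
theorem mul_mem_span_monomial {u : GWA σ a} {τ : R → R}
    (hτ : ∀ r, u * coeff σ a r = coeff σ a (τ r) * u)
    (hu : ∀ i, ∃ (r : R) (j : ℤ), u * monomial σ a i = r • monomial σ a j) {v : GWA σ a}
    (hv : v ∈ Submodule.span R (Set.range (monomial σ a))) :
    u * v ∈ Submodule.span R (Set.range (monomial σ a)) := by
  induction hv using Submodule.span_induction with
  | mem v hv =>
    obtain ⟨i, rfl⟩ := hv
    obtain ⟨r, j, hr⟩ := hu i
    exact hr ▸ Submodule.smul_mem _ r (Submodule.subset_span ⟨j, rfl⟩)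
  | zero => rw [mul_zero]; exact zero_mem _
  | add v w _ _ hv hw => rw [mul_add]; exact add_mem hv hw
  | smul r v _ hv =>
    rw [smul_def, ← mul_assoc, hτ, mul_assoc]
    exact Submodule.smul_mem _ (τ r) hv

theorem span_monomial : Submodule.span R (Set.range (monomial σ a)) = ⊤ := by
  suffices hmul : ∀ b, ∀ v ∈ Submodule.span R (Set.range (monomial σ a)),
      b * v ∈ Submodule.span R (Set.range (monomial σ a)) from
    eq_top_iff.mpr fun b _ => mul_one b ▸ hmul b 1
      (Submodule.subset_span ⟨0, monomial_zero σ a⟩)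
  intro b
  induction b using GWA.induction with
  | coeff r => exact fun v => Submodule.smul_mem _ r
  | x =>
    exact fun v => mul_mem_span_monomial (x_mul_coeff σ a) fun i =>
      (exists_x_mul_monomial_eq_smul σ a i).imp fun _ h => ⟨_, h⟩
  | y =>
    exact fun v => mul_mem_span_monomial (y_mul_coeff σ a) fun i =>
      (exists_y_mul_monomial_eq_smul σ a i).imp fun _ h => ⟨_, h⟩
  | mul b c hb hc => exact fun v hv => (mul_assoc b c v).symm ▸ hb _ (hc _ hv)
  | add b c hb hc => exact fun v hv => (add_mul b c v).symm ▸ add_mem (hb _ hv) (hc _ hv)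

/-- The coefficients of an element of `R(σ, a)`, viewed as a skew Laurent polynomial with
`y = a x⁻¹`. -/
noncomputable def coord : GWA σ a →ₗ[R] (ℤ →₀ R) where
  toFun b := toEnd σ a b (.single 0 1)
  map_add' b c := by rw [map_add, LinearMap.add_apply]
  map_smul' r b := toEnd_coeff_mul_apply σ a r b _

theorem coord_apply (b : GWA σ a) : coord σ a b = toEnd σ a b (.single 0 1) := rfl

theorem coord_mul (b c : GWA σ a) : coord σ a (b * c) = toEnd σ a b (coord σ a c) := by
  rw [coord_apply, map_mul]
  rfl

theorem coord_coeff (r : R) : coord σ a (coeff σ a r) = .single 0 r := by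
  rw [coord_apply, toEnd_coeff]
  simp

theorem coeff_injective : Function.Injective (coeff σ a) := fun r s h =>
  Finsupp.single_injective (0 : ℤ) (by simpa only [coord_coeff] using congrArg (coord σ a) h)

theorem x_ne_zero [Nontrivial R] : x σ a ≠ 0 := fun h => by
  have hx : coord σ a (x σ a) = .single 1 1 := by
    simp [coord_apply, toEnd_x, skewShift_single]
  simp [h, eq_comm] at hx

theorem toEnd_y_pow (n : ℕ) : toEnd σ a (y σ a ^ n) =
    Algebra.lsmul k k (ℤ →₀ R) (∏ i ∈ Finset.range n, (σ ^ (-i : ℤ)) a) * skewShift σ (-n) := by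
  induction n with
  | zero => simp [skewShift_zero]
  | succ n ih =>
    rw [pow_succ, map_mul, ih, toEnd_y, mul_assoc, ← mul_assoc (skewShift σ _),
      skewShift_mul_lsmul, mul_assoc, ← skewShift_add, ← mul_assoc, ← map_mul,
      ← Finset.prod_range_succ, Nat.cast_succ, neg_add]

/-- The coefficient of `monomial σ a i` as a skew Laurent monomial: `1` for `xⁿ`, and
`a σ⁻¹(a) ⋯ σ¹⁻ⁿ(a)` for `yⁿ = (a x⁻¹)ⁿ`. -/
def monomialCoeff : ℤ → R
  | .ofNat _ => 1
  | .negSucc n => ∏ i ∈ Finset.range (n + 1), (σ ^ (-i : ℤ)) a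

theorem toEnd_monomial (i : ℤ) : toEnd σ a (monomial σ a i) =
    Algebra.lsmul k k (ℤ →₀ R) (monomialCoeff σ a i) * skewShift σ i := by
  cases i with
  | ofNat n =>
    rw [monomial, map_pow, toEnd_x, monomialCoeff, map_one, one_mul]
    induction n with
    | zero => exact (skewShift_zero σ).symm
    | succ n ih => rw [pow_succ, ih, ← skewShift_add]; rfl
  | negSucc n => exact toEnd_y_pow σ a (n + 1)

theorem coord_monomial (i : ℤ) : coord σ a (monomial σ a i) = .single i (monomialCoeff σ a i) := by
  simp [coord_apply, toEnd_monomial, skewShift_single]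

theorem toEnd_apply (b : GWA σ a) (f : ℤ →₀ R) (j : ℤ) :
    toEnd σ a b f j = (coord σ a b).sum fun i r => r * (σ ^ i) (f (j - i)) := by
  have hb : b ∈ Submodule.span R (Set.range (monomial σ a)) := span_monomial σ a ▸ trivial
  induction hb using Submodule.span_induction with
  | mem b hb =>
    obtain ⟨i, rfl⟩ := hb
    simp [coord_monomial, toEnd_monomial]
  | zero => simp
  | add b c _ _ hb hc =>
    rw [map_add, map_add, Finsupp.sum_add_index' (by simp) (by simp [add_mul]), ← hb, ← hc]
    rfl
  | smul r b _ hb =>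
    rw [map_smul (coord σ a), Finsupp.sum_smul_index (by simp), smul_def, toEnd_coeff_mul_apply]
    simp [hb, Finsupp.mul_sum, mul_assoc]

theorem coord_mul_apply (b c : GWA σ a) (j : ℤ) :
    coord σ a (b * c) j = (coord σ a b).sum fun i r => r * (σ ^ i) (coord σ a c (j - i)) := by
  rw [coord_mul, toEnd_apply]

variable {σ a}

/-- The leading coefficient of an element of `R(σ, a)`, viewed as a skew Laurent polynomial. -/
noncomputable def leadingCoeff (b : GWA σ a) : R := topCoeff (coord σ a b)

theorem leadingCoeff_coeff (r : R) : leadingCoeff (coeff σ a r) = r := by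
  rw [leadingCoeff, coord_coeff, topCoeff_single]

end Generators

section Domain

variable {k : Type*} [CommRing k] {R : Type*} [CommRing R] [IsDomain R] [Algebra k R]
  {σ : R ≃ₐ[k] R} {a : R}

attribute [local instance] leftModule isScalarTower_leftModule

theorem monomialCoeff_ne_zero (ha : a ≠ 0) (i : ℤ) : monomialCoeff σ a i ≠ 0 := by
  cases i with
  | ofNat => exact one_ne_zero
  | negSucc =>
    exact Finset.prod_ne_zero_iff.mpr fun i _ =>
      (map_ne_zero_iff _ (σ ^ (-i : ℤ)).injective).mpr ha

theorem linearIndependent_coord_monomial (ha : a ≠ 0) :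
    LinearIndependent R (coord σ a ∘ monomial σ a) := by
  rw [show coord σ a ∘ monomial σ a = _ from funext (coord_monomial σ a)]
  exact Finsupp.linearIndependent_single_of_ne_zero (monomialCoeff_ne_zero ha)

theorem coord_injective (ha : a ≠ 0) : Function.Injective (coord σ a) := by
  rw [← LinearMap.ker_eq_bot]
  have h := Submodule.range_ker_disjoint (linearIndependent_coord_monomial (σ := σ) ha)
  rwa [span_monomial, top_disjoint] at h

theorem leadingCoeff_eq_zero_iff (ha : a ≠ 0) {b : GWA σ a} : leadingCoeff b = 0 ↔ b = 0 := by
  rw [leadingCoeff, topCoeff_eq_zero_iff, map_eq_zero_iff _ (coord_injective ha)]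

theorem leadingCoeff_mul (b c : GWA σ a) : leadingCoeff (b * c) =
    leadingCoeff b * (σ ^ topDegree (coord σ a b)) (leadingCoeff c) :=
  topCoeff_eq_mul_of_convolution (τ := fun i => σ ^ i)
    (fun i _ => map_eq_zero_iff _ (σ ^ i).injective) (coord_mul_apply σ a b c)

theorem isDomain (ha : a ≠ 0) : IsDomain (GWA σ a) := by
  have : Nontrivial (GWA σ a) := (coeff_injective σ a).nontrivial
  have : NoZeroDivisors (GWA σ a) := ⟨fun {b c} hbc => by
    rw [← leadingCoeff_eq_zero_iff ha, leadingCoeff_mul] at hbc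
    simpa [leadingCoeff_eq_zero_iff ha] using hbc⟩
  exact NoZeroDivisors.to_isDomain _

end Domain

section LeadingCoeffHom

variable {k : Type*} [CommRing k] {R : Type*} [CommRing R] [Algebra k R]
  {σ : R ≃ₐ[k] R} {a : R} {Γ : Type*} [CommGroupWithZero Γ] {l : R →*₀ Γ}

theorem map_zpow_apply_of_invariant (hσ : ∀ r, l (σ r) = l r) (n : ℤ) (r : R) :
    l ((σ ^ n) r) = l r := by
  induction n generalizing r with
  | zero => rfl
  | succ n ih => rw [zpow_add_one, AlgEquiv.mul_apply, ih, hσ]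
  | pred n ih =>
    rw [← ih r, ← hσ, ← AlgEquiv.mul_apply, ← zpow_one_add, add_sub_left_comm, sub_self, add_zero]

variable [IsDomain R]

/-- The extension of a `σ`-invariant multiplicative function on `R` to `R(σ, a)` by its value on
leading coefficients. -/
noncomputable def mapLeadingCoeff (ha : a ≠ 0) (hσ : ∀ r, l (σ r) = l r) : GWA σ a →*₀ Γ where
  toFun b := l (leadingCoeff b)
  map_zero' := by rw [(leadingCoeff_eq_zero_iff ha).mpr rfl, map_zero]
  map_one' := by rw [← map_one (coeff σ a), leadingCoeff_coeff, map_one]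
  map_mul' b c := by rw [leadingCoeff_mul, map_mul, map_zpow_apply_of_invariant hσ]

theorem mapLeadingCoeff_coeff (ha : a ≠ 0) (hσ : ∀ r, l (σ r) = l r) (r : R) :
    mapLeadingCoeff ha hσ (coeff σ a r) = l r :=
  congrArg l (leadingCoeff_coeff r)

theorem eq_zero_of_mapLeadingCoeff_eq_zero (ha : a ≠ 0) (hσ : ∀ r, l (σ r) = l r)
    (hl : ∀ r, l r = 0 → r = 0) (b : GWA σ a) (hb : mapLeadingCoeff ha hσ b = 0) : b = 0 :=
  (leadingCoeff_eq_zero_iff ha).mp (hl _ hb)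

end LeadingCoeffHom

section Ore

variable {k : Type*} [CommRing k] {R : Type*} [CommRing R] [Algebra k R] {σ : R ≃ₐ[k] R} {a : R}

attribute [local instance] leftModule isScalarTower_leftModule

theorem coord_monomial_mul_apply (i : ℤ) (b : GWA σ a) (j : ℤ) :
    coord σ a (monomial σ a i * b) j = monomialCoeff σ a i * (σ ^ i) (coord σ a b (j - i)) := by
  rw [coord_mul, toEnd_monomial]
  simp

theorem exists_support_coord_subset_Icc (b : GWA σ a) :
    ∃ N : ℕ, (coord σ a b).support ⊆ Finset.Icc (-N : ℤ) N := by
  refine ⟨(coord σ a b).support.sup Int.natAbs, fun j hj => ?_⟩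
  have := Finset.le_sup (f := Int.natAbs) hj
  rw [Finset.mem_Icc]
  omega

theorem support_coord_monomial_mul_subset {M N : ℕ} {i : ℤ} (hi : i ∈ Finset.Icc (-M : ℤ) M)
    {b : GWA σ a} (hb : (coord σ a b).support ⊆ Finset.Icc (-N : ℤ) N) :
    (coord σ a (monomial σ a i * b)).support ⊆ Finset.Icc (-(M + N) : ℤ) (M + N) := by
  intro j hj
  rw [Finsupp.mem_support_iff, coord_monomial_mul_apply] at hj
  have hji : coord σ a b (j - i) ≠ 0 := fun h => hj (by rw [h, map_zero, mul_zero])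
  have := hb (Finsupp.mem_support_iff.mpr hji)
  simp only [Finset.mem_Icc] at hi this ⊢
  omega

/-- The map `(s, t) ↦ s b + t c` of left `R`-modules. -/
noncomputable def mulAddMul (b c : GWA σ a) : GWA σ a × GWA σ a →ₗ[R] GWA σ a :=
  ((LinearMap.toSpanSingleton _ _ b).coprod (LinearMap.toSpanSingleton _ _ c)).restrictScalars R

variable [IsDomain R]

-- Otherwise the `2 (2N + 1)` elements `mᵢ b`, `mᵢ c` with `|i| ≤ N` and `mᵢ` the monomials would
-- be linearly independent, while for large `N` their coefficients lie in degrees `|j| ≤ 2N`.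
theorem exists_mul_add_mul_eq_zero (ha : a ≠ 0) (b c : GWA σ a) :
    ∃ s t : GWA σ a, (s, t) ≠ 0 ∧ s * b + t * c = 0 := by
  obtain ⟨N₁, hb⟩ := exists_support_coord_subset_Icc b
  obtain ⟨N₂, hc⟩ := exists_support_coord_subset_Icc c
  let N := max N₁ N₂
  let J := Finset.Icc (-N : ℤ) N
  have hsupport {d : GWA σ a} {n : ℕ} (hn : n ≤ N)
      (hd : (coord σ a d).support ⊆ Finset.Icc (-n : ℤ) n) (i : J) :
      (coord σ a (monomial σ a i * d)).support ⊆ Finset.Icc (-(N + N) : ℤ) (N + N) :=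
    support_coord_monomial_mul_subset i.2
      (hd.trans (Finset.Icc_subset_Icc (by omega) (by omega)))
  let m : J → GWA σ a := fun i => monomial σ a i
  have hm : LinearIndependent R m :=
    ((linearIndependent_coord_monomial ha).of_comp _).comp _ Subtype.val_injective
  by_contra! hinj
  have hker : LinearMap.ker (coord σ a ∘ₗ mulAddMul b c) = ⊥ := by
    rw [LinearMap.ker_comp_of_ker_eq_bot _ (LinearMap.ker_eq_bot.mpr (coord_injective ha)),
      eq_bot_iff]
    rintro ⟨s, t⟩ hst
    by_contra h
    exact hinj s t h hst
  have hcard := card_le_card_of_linearIndependent_of_support_subset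
    (s := Finset.Icc (-(N + N) : ℤ) (N + N))
    ((linearIndependent_inl_union_inr' hm hm).map' _ hker) (Sum.rec
      (fun i => by simpa [mulAddMul, m] using hsupport (le_max_left _ _) hb i)
      (fun i => by simpa [mulAddMul, m] using hsupport (le_max_right _ _) hc i))
  simp only [J, Fintype.card_sum, Fintype.card_coe, Int.card_Icc] at hcard
  omega

theorem nonempty_oreSet_nonZeroDivisors (ha : a ≠ 0) :
    Nonempty (OreLocalization.OreSet (nonZeroDivisors (GWA σ a))) := by
  have := isDomain (σ := σ) ha
  refine OreLocalization.nonempty_oreSet_iff_of_noZeroDivisors.mpr fun b c => ?_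
  obtain ⟨s, t, hst, h⟩ := exists_mul_add_mul_eq_zero ha b (c : GWA σ a)
  have hs : s ≠ 0 := by
    rintro rfl
    rw [zero_mul, zero_add, mul_eq_zero] at h
    exact hst (Prod.ext rfl (h.resolve_right (nonZeroDivisors.ne_zero c.2)))
  exact ⟨-t, ⟨s, mem_nonZeroDivisors_of_ne_zero hs⟩,
    (eq_neg_of_add_eq_zero_left h).trans (neg_mul t c).symm⟩

end Ore

section MoritaInvariants

theorem isUnit_of_fixed_of_isSimpleRing {k : Type*} [CommRing k] {R : Type*} [CommRing R]
    [Algebra k R] {σ : R ≃ₐ[k] R} {a : R} (h : IsSimpleRing (GWA σ a)) {r : R} (hr : r ≠ 0)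
    (hσ : σ r = r) : IsUnit r := by
  have hcenter : coeff σ a r ∈ Subring.center (GWA σ a) :=
    Subring.mem_center_iff.mpr fun b => (commute_coeff_of_fixed hσ b).symm
  have hcoeff : coeff σ a r ≠ 0 := (map_ne_zero_iff _ (coeff_injective σ a)).mpr hr
  obtain ⟨⟨b, _⟩, hb⟩ := (IsSimpleRing.isField_center (GWA σ a)).mul_inv_cancel
    (a := ⟨coeff σ a r, hcenter⟩) fun h0 => hcoeff (congrArg Subtype.val h0)
  have hb' : coeff σ a r * b = coeff σ a 1 := (congrArg Subtype.val hb).trans (map_one _).symm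
  have hcoord : coord σ a (coeff σ a r * b) 0 = coord σ a (coeff σ a 1) 0 := by rw [hb']
  rw [coord_mul, toEnd_coeff, coord_coeff, Finsupp.single_eq_same] at hcoord
  exact .of_mul_eq_one _ hcoord

universe u

theorem map_algebraMap_eq_one_of_isMoritaEquivalent {k : Type*} [CommRing k] {R S : Type u}
    [CommRing R] [IsDomain R] [Algebra k R] {σ : R ≃ₐ[k] R} {a : R} [CommRing S] [IsDomain S]
    [Algebra k S] {τ : S ≃ₐ[k] S} {b : S} (h : IsMoritaEquivalent k (GWA σ a) (GWA τ b))
    (ha : a ≠ 0) (hb : b ≠ 0) {Γ : Type*} [CommGroupWithZero Γ] {l : S →*₀ Γ}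
    (hl : ∀ s, l s = 0 → s = 0) (hτ : ∀ s, l (τ s) = l s) {c : k} {r : R} (hr : r ≠ 0)
    (hσ : σ r = algebraMap k R c * r) : l (algebraMap k S c) = 1 := by
  have := isDomain (σ := σ) ha
  have := isDomain (σ := τ) hb
  obtain ⟨_⟩ := nonempty_oreSet_nonZeroDivisors (σ := τ) hb
  have hx : x σ a * coeff σ a r = algebraMap k _ c * (coeff σ a r * x σ a) := by
    rw [x_mul_coeff, hσ, map_mul, AlgHom.commutes, mul_assoc]
  rw [← mapLeadingCoeff_coeff hb hτ, AlgHom.commutes]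
  exact _root_.map_algebraMap_eq_one_of_isMoritaEquivalent h
    (eq_zero_of_mapLeadingCoeff_eq_zero hb hτ hl) (x_ne_zero σ a)
    ((map_ne_zero_iff _ (coeff_injective σ a)).mpr hr) hx

theorem mem_of_isMoritaEquivalent {k : Type*} [Field k] {R S : Type u} [CommRing R] [IsDomain R]
    [Algebra k R] {σ : R ≃ₐ[k] R} {a : R} [CommRing S] [IsDomain S] [Algebra k S]
    {τ : S ≃ₐ[k] S} {b : S} (h : IsMoritaEquivalent k (GWA σ a) (GWA τ b)) (ha : a ≠ 0)
    (hb : b ≠ 0) {l : S →*₀ k} (hl : ∀ s, l s = 0 → s = 0)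
    (hlk : ∀ c, l (algebraMap k S c) = c) {H : Subgroup kˣ}
    (hτ : ∀ s, ∃ u ∈ H, l (τ s) = l s * u) {q : kˣ} {r : R} (hr : r ≠ 0)
    (hσ : σ r = algebraMap k R q * r) : q ∈ H := by
  obtain ⟨G, _, f, rfl⟩ : ∃ (G : Type _) (_ : CommGroup G) (f : kˣ →* G), f.ker = H :=
    ⟨kˣ ⧸ H, inferInstance, QuotientGroup.mk' H, QuotientGroup.ker_mk' H⟩
  have hf (s : S) : withZeroHomOfUnits f (l (τ s)) = withZeroHomOfUnits f (l s) := by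
    obtain ⟨u, hu, hτu⟩ := hτ s
    rw [hτu, map_mul, withZeroHomOfUnits_eq_one_iff.mpr hu, mul_one]
  have hq := map_algebraMap_eq_one_of_isMoritaEquivalent h ha hb
    (l := (withZeroHomOfUnits f).comp l)
    (fun s hs => hl s ((map_eq_zero (withZeroHomOfUnits f)).mp hs)) hf hr hσ
  rwa [MonoidWithZeroHom.comp_apply, hlk, withZeroHomOfUnits_eq_one_iff] at hq

end MoritaInvariants

end GWA

section LeadingCoefficients

variable {k : Type*} [Field k]

theorem sigmaCl_apply (p : k[X]) : sigmaCl k p = p.comp (Polynomial.X - 1) := rfl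

theorem sigmaQ_apply (q : kˣ) (p : k[X]) :
    sigmaQ q p = p.comp (Polynomial.C (q : k) * Polynomial.X) := rfl

theorem sigmaQ_X (q : kˣ) :
    sigmaQ q Polynomial.X = algebraMap k k[X] (q : k) * Polynomial.X := by
  simp [sigmaQ_apply]

theorem sigmaQ_one : sigmaQ (1 : kˣ) = AlgEquiv.refl := by
  ext p
  simp [sigmaQ_apply]

theorem leadingCoeff_sigmaCl (p : k[X]) : (sigmaCl k p).leadingCoeff = p.leadingCoeff := by
  have hX : (Polynomial.X - 1 : k[X]) = Polynomial.X - Polynomial.C 1 := by simp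
  rw [sigmaCl_apply, hX, Polynomial.leadingCoeff_comp
    (by rw [Polynomial.natDegree_X_sub_C]; exact one_ne_zero), Polynomial.leadingCoeff_X_sub_C,
    one_pow, mul_one]

theorem leadingCoeff_sigmaQ (q : kˣ) (p : k[X]) :
    (sigmaQ q p).leadingCoeff = p.leadingCoeff * ((q ^ p.natDegree : kˣ) : k) := by
  rw [sigmaQ_apply, Polynomial.leadingCoeff_comp
    (by rw [Polynomial.natDegree_C_mul_X _ q.ne_zero]; exact one_ne_zero),
    Polynomial.leadingCoeff_mul, Polynomial.leadingCoeff_C, Polynomial.leadingCoeff_X, mul_one,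
    Units.val_pow_eq_pow_val]

/-- The leading coefficient of a polynomial as a homomorphism of monoids with zero. -/
noncomputable def polynomialLeadingCoeffHom (k : Type*) [Field k] : k[X] →*₀ k :=
  { Polynomial.leadingCoeffHom with map_zero' := Polynomial.leadingCoeff_zero }

theorem sigmaQLaurent_T (q : kˣ) (n : ℤ) :
    sigmaQLaurent q (LaurentPolynomial.T n) = ((q ^ n : kˣ) : k) • LaurentPolynomial.T n :=
  laurentScale_T q n

theorem sigmaQLaurent_T_one (q : kˣ) : sigmaQLaurent q (LaurentPolynomial.T 1) =
    algebraMap k k[T;T⁻¹] q * LaurentPolynomial.T 1 := by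
  rw [sigmaQLaurent_T, zpow_one, Algebra.smul_def]

theorem coeff_sigmaQLaurent (q : kˣ) (f : k[T;T⁻¹]) (n : ℤ) :
    (sigmaQLaurent q f).coeff n = ((q ^ n : kˣ) : k) * f.coeff n := by
  induction f using LaurentPolynomial.induction_on' with
  | add f g hf hg => simp [hf, hg, mul_add]
  | C_mul_T m c =>
    rw [← LaurentPolynomial.smul_eq_C_mul, map_smul, sigmaQLaurent_T]
    obtain rfl | hmn := eq_or_ne m n
    · simp [mul_comm]
    · simp [hmn]

theorem sigmaQLaurent_one : sigmaQLaurent (1 : kˣ) = AlgEquiv.refl := by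
  ext f n
  simp [coeff_sigmaQLaurent]

/-- The coefficient of largest degree of a Laurent polynomial as a homomorphism of monoids with
zero. -/
noncomputable def laurentLeadingCoeffHom (k : Type*) [Field k] : k[T;T⁻¹] →*₀ k where
  toFun f := topCoeff f.coeff
  map_zero' := topCoeff_eq_zero_iff.mpr rfl
  map_one' := topCoeff_single 0 1
  map_mul' f g := topCoeff_eq_mul_of_convolution (τ := fun _ r => r) (fun _ _ => Iff.rfl)
    fun j => by simp [AddMonoidAlgebra.coeff_mul_apply_left, sub_eq_neg_add]

theorem laurentLeadingCoeffHom_algebraMap (c : k) :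
    laurentLeadingCoeffHom k (algebraMap k k[T;T⁻¹] c) = c :=
  topCoeff_single 0 c

theorem eq_zero_of_laurentLeadingCoeffHom_eq_zero {f : k[T;T⁻¹]}
    (hf : laurentLeadingCoeffHom k f = 0) : f = 0 :=
  AddMonoidAlgebra.coeff_injective (topCoeff_eq_zero_iff.mp hf)

theorem laurentLeadingCoeffHom_sigmaQLaurent (q : kˣ) (f : k[T;T⁻¹]) :
    laurentLeadingCoeffHom k (sigmaQLaurent q f) =
      laurentLeadingCoeffHom k f * ((q ^ topDegree f.coeff : kˣ) : k) := by
  have hsupport : (sigmaQLaurent q f).coeff.support = f.coeff.support := by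
    ext n
    simp [coeff_sigmaQLaurent, zpow_ne_zero]
  have hdegree : topDegree (sigmaQLaurent q f).coeff = topDegree f.coeff := by
    rw [topDegree, hsupport, topDegree]
  change topCoeff _ = topCoeff _ * _
  rw [topCoeff, hdegree, coeff_sigmaQLaurent, topCoeff, mul_comm]

end LeadingCoefficients

section Classification

variable {k : Type*} [Field k]

theorem not_commute_x_coeff_X (a : k[X]) :
    ¬ Commute (GWA.x (sigmaCl k) a) (GWA.coeff (sigmaCl k) a Polynomial.X) := by
  intro h
  rw [commute_iff_eq, GWA.x_mul_coeff, sigmaCl_apply, Polynomial.X_comp, map_sub, map_one,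
    sub_mul, one_mul, sub_eq_self] at h
  exact GWA.x_ne_zero _ a h

theorem eq_one_of_isMoritaEquivalent_classicalGWA.{u} {k R : Type u} [Field k] [CommRing R]
    [IsDomain R] [Algebra k R] {σ : R ≃ₐ[k] R} {a : R} {a' : k[X]}
    (h : IsMoritaEquivalent k (GWA σ a) (ClassicalGWA a')) (ha : a ≠ 0) (ha' : a' ≠ 0) {q : kˣ}
    {r : R} (hr : r ≠ 0) (hσ : σ r = algebraMap k R q * r) : q = 1 :=
  Subgroup.mem_bot.mp (GWA.mem_of_isMoritaEquivalent h ha ha' (l := polynomialLeadingCoeffHom k)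
    (fun _ => Polynomial.leadingCoeff_eq_zero.mp) Polynomial.leadingCoeff_C
    (fun p => ⟨1, one_mem _, (leadingCoeff_sigmaCl p).trans (mul_one _).symm⟩) hr hσ)

theorem not_isMoritaEquivalent_classicalGWA_refl.{u} {k R : Type u} [Field k] [CommRing R]
    [IsDomain R] [Algebra k R] {a : k[X]} {b : R} (ha : a ≠ 0) (hb : b ≠ 0) :
    ¬ IsMoritaEquivalent k (ClassicalGWA a) (GWA (AlgEquiv.refl : R ≃ₐ[k] R) b) := fun h => by
  have := GWA.isDomain (σ := sigmaCl k) ha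
  have := GWA.isDomain (σ := (AlgEquiv.refl : R ≃ₐ[k] R)) hb
  exact not_commute_x_coeff_X a (mul_comm_of_isMoritaEquivalent h GWA.commute_of_eq_refl _ _)

theorem mem_zpowers_of_isMoritaEquivalent_quantumGWA {q₁ q₂ : kˣ} {a₁ a₂ : k[X]}
    (h : IsMoritaEquivalent k (QuantumGWA q₁ a₁) (QuantumGWA q₂ a₂)) (ha₁ : a₁ ≠ 0)
    (ha₂ : a₂ ≠ 0) : q₁ ∈ Subgroup.zpowers q₂ :=
  GWA.mem_of_isMoritaEquivalent h ha₁ ha₂ (l := polynomialLeadingCoeffHom k)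
    (fun _ => Polynomial.leadingCoeff_eq_zero.mp) Polynomial.leadingCoeff_C
    (fun p => ⟨_, Subgroup.npow_mem_zpowers q₂ p.natDegree, leadingCoeff_sigmaQ q₂ p⟩)
    Polynomial.X_ne_zero (sigmaQ_X q₁)

theorem mem_zpowers_of_isMoritaEquivalent_laurentQuantumGWA {q₁ q₂ : kˣ} {a₁ a₂ : k[T;T⁻¹]}
    (h : IsMoritaEquivalent k (LaurentQuantumGWA q₁ a₁) (LaurentQuantumGWA q₂ a₂))
    (ha₁ : a₁ ≠ 0) (ha₂ : a₂ ≠ 0) : q₁ ∈ Subgroup.zpowers q₂ :=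
  GWA.mem_of_isMoritaEquivalent h ha₁ ha₂ (l := laurentLeadingCoeffHom k)
    (fun _ => eq_zero_of_laurentLeadingCoeffHom_eq_zero) laurentLeadingCoeffHom_algebraMap
    (fun f => ⟨_, Subgroup.zpow_mem_zpowers q₂ _, laurentLeadingCoeffHom_sigmaQLaurent q₂ f⟩)
    (LaurentPolynomial.isUnit_T 1).ne_zero (sigmaQLaurent_T_one q₁)

theorem not_isOfFinOrder_of_isSimpleRing {q : kˣ} {a : k[T;T⁻¹]}
    (h : IsSimpleRing (LaurentQuantumGWA q a)) : ¬ IsOfFinOrder q := by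
  intro hq
  obtain ⟨n, hn, hqn⟩ := hq.exists_pow_eq_one
  let t : k[T;T⁻¹] := LaurentPolynomial.T n - 1
  have hfixed : sigmaQLaurent q t = t := by
    rw [map_sub, map_one, sigmaQLaurent_T, zpow_natCast, hqn, Units.val_one, one_smul]
  have ht : t ≠ 0 := fun h0 => by
    have := congrArg (fun f : k[T;T⁻¹] => f.coeff 0) h0
    simp [t, ← LaurentPolynomial.T_zero, hn.ne'] at this
  have hunit := (GWA.isUnit_of_fixed_of_isSimpleRing h ht hfixed).map
    (LaurentPolynomial.eval₂ (RingHom.id k) 1)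
  simp [t] at hunit

end Classification

theorem proposition3p1p3_general (k : Type*) [Field k] :
    ((∀ a₁ : k[X], a₁ ≠ 0 → ∀ q : kˣ,
        (∀ a₂ : k[X], a₂ ≠ 0 →
          ¬ IsMoritaEquivalent k (ClassicalGWA a₁) (QuantumGWA q a₂)) ∧
        (∀ a₂ : k[T;T⁻¹], a₂ ≠ 0 →
          ¬ IsMoritaEquivalent k (ClassicalGWA a₁) (LaurentQuantumGWA q a₂))) ∧
      (∀ (q₁ q₂ : kˣ) (a₁ a₂ : k[X]), a₁ ≠ 0 → a₂ ≠ 0 →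
        IsMoritaEquivalent k (QuantumGWA q₁ a₁) (QuantumGWA q₂ a₂) →
        Subgroup.zpowers q₁ = Subgroup.zpowers q₂) ∧
      (∀ (q₁ q₂ : kˣ) (a₁ a₂ : k[T;T⁻¹]), a₁ ≠ 0 → a₂ ≠ 0 →
        IsMoritaEquivalent k (LaurentQuantumGWA q₁ a₁) (LaurentQuantumGWA q₂ a₂) →
        Subgroup.zpowers q₁ = Subgroup.zpowers q₂ ∧
          (IsSimpleRing (LaurentQuantumGWA q₁ a₁) → q₂ = q₁ ∨ q₂ = q₁⁻¹))) := by
  refine ⟨fun a₁ ha₁ q => ⟨fun a₂ ha₂ h => ?_, fun a₂ ha₂ h => ?_⟩,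
    fun q₁ q₂ a₁ a₂ ha₁ ha₂ h => ?_, fun q₁ q₂ a₁ a₂ ha₁ ha₂ h => ?_⟩
  · obtain rfl : q = 1 := eq_one_of_isMoritaEquivalent_classicalGWA h.symm ha₂ ha₁
      Polynomial.X_ne_zero (sigmaQ_X q)
    exact not_isMoritaEquivalent_classicalGWA_refl ha₁ ha₂ (sigmaQ_one (k := k) ▸ h)
  · obtain rfl : q = 1 := eq_one_of_isMoritaEquivalent_classicalGWA h.symm ha₂ ha₁
      (LaurentPolynomial.isUnit_T 1).ne_zero (sigmaQLaurent_T_one q)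
    exact not_isMoritaEquivalent_classicalGWA_refl ha₁ ha₂ (sigmaQLaurent_one (k := k) ▸ h)
  · exact le_antisymm
      (Subgroup.zpowers_le.mpr (mem_zpowers_of_isMoritaEquivalent_quantumGWA h ha₁ ha₂))
      (Subgroup.zpowers_le.mpr (mem_zpowers_of_isMoritaEquivalent_quantumGWA h.symm ha₂ ha₁))
  · have hq : Subgroup.zpowers q₁ = Subgroup.zpowers q₂ := le_antisymm
      (Subgroup.zpowers_le.mpr (mem_zpowers_of_isMoritaEquivalent_laurentQuantumGWA h ha₁ ha₂))
      (Subgroup.zpowers_le.mpr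
        (mem_zpowers_of_isMoritaEquivalent_laurentQuantumGWA h.symm ha₂ ha₁))
    exact ⟨hq, fun hsimple => ((Subgroup.zpowers_eq_zpowers_iff
      (not_isOfFinOrder_of_isSimpleRing hsimple)).mp hq).imp Eq.symm Eq.symm⟩

theorem proposition3p1p3 (k : Type*) [Field k] [IsAlgClosed k] [CharZero k] :
    ((∀ a₁ : k[X], a₁ ≠ 0 → ∀ q : kˣ,
        (∀ a₂ : k[X], a₂ ≠ 0 →
          ¬ IsMoritaEquivalent k (ClassicalGWA a₁) (QuantumGWA q a₂)) ∧
        (∀ a₂ : k[T;T⁻¹], a₂ ≠ 0 →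
          ¬ IsMoritaEquivalent k (ClassicalGWA a₁) (LaurentQuantumGWA q a₂))) ∧
      (∀ (q₁ q₂ : kˣ) (a₁ a₂ : k[X]), a₁ ≠ 0 → a₂ ≠ 0 →
        IsMoritaEquivalent k (QuantumGWA q₁ a₁) (QuantumGWA q₂ a₂) →
        Subgroup.zpowers q₁ = Subgroup.zpowers q₂) ∧
      (∀ (q₁ q₂ : kˣ) (a₁ a₂ : k[T;T⁻¹]), a₁ ≠ 0 → a₂ ≠ 0 →
        IsSimpleRing (LaurentQuantumGWA q₁ a₁) → IsSimpleRing (LaurentQuantumGWA q₂ a₂) →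
        IsMoritaEquivalent k (LaurentQuantumGWA q₁ a₁) (LaurentQuantumGWA q₂ a₂) →
        q₂ = q₁ ∨ q₂ = q₁⁻¹)) := by
  obtain ⟨hcl, hq, hl⟩ := proposition3p1p3_general k
  exact ⟨hcl, hq, fun q₁ q₂ a₁ a₂ ha₁ ha₂ hs _ h => (hl q₁ q₂ a₁ a₂ ha₁ ha₂ h).2 hs⟩
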